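/- Let $C \subseteq \mathbb{R}^n$ be nonempty, compact and convex, and let $F : C \to \mathbb{R}^n$ be $C^1$ and monotone, i.e. $\langle F(x)-F(y), x-y\rangle \ge 0$ for all $x,y \in C$. Let $$\mathrm{SOL}(C,F) := \{x \in C : \langle F(x), z-x\rangle \ge 0 \ \text{ for all } z \in C\}$$ be the solution set of the associated variational inequality, and for $\pi \in \mathbb{R}^n$ let $\beta(\pi) := \operatorname{argmin}_{s\in C} \langle \pi, s\rangle$ be the set of all minimizers. Let $(\gamma_k)_{k\ge 1}$ satisfy $\gamma_k \in (0,1]$, $\gamma_k \to 0$ and $\sum_{k=1}^\infty \gamma_k = \infty$, and let $(x_k)_{k\ge 0}$ be any sequence with $x_0 \in C$ and $$x_{k+1} = x_k + \gamma_{k+1}(s_k - x_k), \qquad s_k \in \beta(F(x_k)), \qquad k \ge 0.$$ Then every cluster point of $(x_k)$ belongs to $\mathrm{SOL}(C,F)$. In particular, $\mathrm{SOL}(C,F)$ is nonempty and $\operatorname{dist}(x_k, \mathrm{SOL}(C,F)) \to 0$ as $k \to \infty$, where $\operatorname{dist}$ is the Euclidean distance to a set. -/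

import Mathlib

open Filter Topology

namespace FWVI

/-- The map `F` is monotone on `C`: `⟪F x - F y, x - y⟫ ≥ 0` for all `x, y ∈ C`. -/
def MonotoneOperatorOn {n : ℕ} (C : Set (EuclideanSpace ℝ (Fin n)))
    (F : EuclideanSpace ℝ (Fin n) → EuclideanSpace ℝ (Fin n)) : Prop :=
  ∀ x ∈ C, ∀ y ∈ C, 0 ≤ inner ℝ (F x - F y) (x - y)

/-- The linear minimization oracle `β(π) = argmin_{s ∈ C} ⟪π, s⟫`, as the set of all minimizers. -/
def lmo {n : ℕ} (C : Set (EuclideanSpace ℝ (Fin n))) (p : EuclideanSpace ℝ (Fin n)) :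
    Set (EuclideanSpace ℝ (Fin n)) :=
  {s | s ∈ C ∧ ∀ z ∈ C, inner ℝ p s ≤ inner ℝ p z}

/-- The solution set `SOL(C, F)` of the variational inequality. -/
def SOL {n : ℕ} (C : Set (EuclideanSpace ℝ (Fin n)))
    (F : EuclideanSpace ℝ (Fin n) → EuclideanSpace ℝ (Fin n)) :
    Set (EuclideanSpace ℝ (Fin n)) :=
  {x | x ∈ C ∧ ∀ z ∈ C, 0 ≤ inner ℝ (F x) (z - x)}

/-- The step sizes `γ₁, γ₂, …` lie in `(0, 1]`, tend to `0`, and have divergent sum.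
The value `γ 0` plays no role. -/
structure IsStepSize (γ : ℕ → ℝ) : Prop where
  pos : ∀ k, 1 ≤ k → 0 < γ k
  le_one : ∀ k, 1 ≤ k → γ k ≤ 1
  tendsto_zero : Tendsto γ atTop (𝓝 0)
  sum_diverges : Tendsto (fun K : ℕ => ∑ k ∈ Finset.Icc 1 K, γ k) atTop atTop

/-- The sequence `x` is generated by the Frank-Wolfe iteration
`x (k+1) = x k + γ (k+1) • (s k - x k)` with `s k ∈ β(F (x k))` and `x 0 ∈ C`
(for an arbitrary selection of minimizers `s k`). -/
structure IsFrankWolfeSeq {n : ℕ} (C : Set (EuclideanSpace ℝ (Fin n)))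
    (F : EuclideanSpace ℝ (Fin n) → EuclideanSpace ℝ (Fin n)) (γ : ℕ → ℝ)
    (x : ℕ → EuclideanSpace ℝ (Fin n)) : Prop where
  init : x 0 ∈ C
  step : ∀ k, ∃ s ∈ lmo C (F (x k)), x (k + 1) = x k + γ (k + 1) • (s - x k)

end FWVI

/-!
A `C¹` map `F` is Lipschitz on the compact convex set `C`; beyond monotonicity, this is all that the
argument needs of `F`. The Frank-Wolfe iteration is
an Euler scheme for the differential inclusion `x' ∈ β(F x) - x`, and the gap function
`V(x) = max_{s ∈ C} ⟪F x, x - s⟫` decays along the solutions of that inclusion: formally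
`V' = -V - ⟪DF(x) x', x'⟫ ≤ -V`. One discrete step need not decrease `V` in this way, because
successive oracle points may jump; only their averages obey the inclusion. So the argument is
carried out for limit curves of the iteration.

Let `a` be a cluster point, `x → a` along an ultrafilter `U` on the indices. Place the iterates at
the times `γ 1 + ⋯ + γ k`, shift time so that step `k` sits at `0`, and let `k → ∞` along `U`. By
compactness this gives a curve `y : ℝ → C` with `y 0 = a`, defined for negative times as well
(`IsFrankWolfeSeq.exists_limit_curve`). The block estimates `ApproxStep` for the iterates
(`IsFrankWolfeSeq.exists_approxStep`) are closed conditions, so they pass to `y` and say that `y` is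
Lipschitz and solves the inclusion.

Although `V` is not differentiable, `y`, `F ∘ y` and `V ∘ y` are Lipschitz functions of time, hence
differentiable almost everywhere, and at such times `(V ∘ y)' ≤ -V ∘ y` (`deriv_gap_le`).
Integrating from `-T` to `0` gives `(1 + T) * V(a) ≤ V(y (-T))` (`gap_mul_le`). As `V` is bounded on
`C` and `T` is arbitrary, `V(a) ≤ 0`, which says that `a` is a solution. The remaining claims follow
from compactness of `C`.
-/

namespace FWVI

/-! ### The gap function -/

section SupportFunction

variable {E : Type*} [NormedAddCommGroup E] [InnerProductSpace ℝ E]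

/-- The minimum `min_{z ∈ C} ⟪q, z⟫`, encoded as an infimum; it is attained when `C` is nonempty
and compact. -/
noncomputable def minInner (C : Set E) (q : E) : ℝ :=
  sInf ((fun z => inner ℝ q z) '' C)

/-- The gap function `V(x) = max_{s ∈ C} ⟪F x, x - s⟫` of the variational inequality, which is
nonnegative on `C` and vanishes exactly at the solutions. -/
noncomputable def gap (C : Set E) (F : E → E) (x : E) : ℝ :=
  inner ℝ (F x) x - minInner C (F x)

variable {C : Set E} {F : E → E}

theorem exists_inner_eq_minInner (hne : C.Nonempty) (hc : IsCompact C) (q : E) :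
    ∃ s ∈ C, inner ℝ q s = minInner C q := by
  have h : ContinuousOn (fun z => inner ℝ q z) C := by fun_prop
  obtain ⟨s, hs, hs'⟩ := (hc.image_of_continuousOn h).sInf_mem (hne.image _)
  exact ⟨s, hs, hs'⟩

theorem minInner_le (hc : IsCompact C) (q : E) {z : E} (hz : z ∈ C) :
    minInner C q ≤ inner ℝ q z := by
  have h : ContinuousOn (fun z => inner ℝ q z) C := by fun_prop
  exact csInf_le (hc.image_of_continuousOn h).bddBelow ⟨z, hz, rfl⟩

theorem minInner_sub_le (hne : C.Nonempty) (hc : IsCompact C) {R : ℝ} (hR : ∀ z ∈ C, ‖z‖ ≤ R)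
    (p q : E) : minInner C p - minInner C q ≤ R * ‖p - q‖ := by
  obtain ⟨s, hs, hsq⟩ := exists_inner_eq_minInner hne hc q
  have h1 := minInner_le hc p hs
  have h2 : inner ℝ (p - q) s ≤ ‖p - q‖ * ‖s‖ := real_inner_le_norm _ _
  have h3 := mul_le_mul_of_nonneg_left (hR s hs) (norm_nonneg (p - q))
  rw [inner_sub_left] at h2
  linarith

theorem abs_minInner_sub_le (hne : C.Nonempty) (hc : IsCompact C) {R : ℝ}
    (hR : ∀ z ∈ C, ‖z‖ ≤ R) (p q : E) : |minInner C p - minInner C q| ≤ R * ‖p - q‖ := by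
  refine abs_sub_le_iff.2 ⟨minInner_sub_le hne hc hR p q, ?_⟩
  rw [norm_sub_rev]
  exact minInner_sub_le hne hc hR q p

theorem continuous_minInner (hne : C.Nonempty) (hc : IsCompact C) :
    Continuous (minInner C) := by
  obtain ⟨R, hR⟩ := hc.isBounded.exists_norm_le
  have hR0 : 0 ≤ R := (norm_nonneg _).trans (hR _ hne.some_mem)
  refine (LipschitzWith.of_dist_le_mul (K := ⟨R, hR0⟩) fun p q => ?_).continuous
  rw [Real.dist_eq, dist_eq_norm]
  exact abs_minInner_sub_le hne hc hR p q

theorem abs_gap_sub_le (hne : C.Nonempty) (hc : IsCompact C) {R B : ℝ} (hR : ∀ z ∈ C, ‖z‖ ≤ R)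
    (hB : ∀ z ∈ C, ‖F z‖ ≤ B) {a b : E} (ha : a ∈ C) (hb : b ∈ C) :
    |gap C F a - gap C F b| ≤ 2 * R * ‖F a - F b‖ + B * ‖a - b‖ := by
  have h1 : |inner ℝ (F a - F b) a| ≤ ‖F a - F b‖ * R :=
    (abs_real_inner_le_norm _ _).trans (mul_le_mul_of_nonneg_left (hR a ha) (norm_nonneg _))
  have h2 : |inner ℝ (F b) (a - b)| ≤ B * ‖a - b‖ :=
    (abs_real_inner_le_norm _ _).trans (mul_le_mul_of_nonneg_right (hB b hb) (norm_nonneg _))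
  have h3 := abs_minInner_sub_le hne hc hR (F a) (F b)
  rw [inner_sub_left] at h1
  rw [inner_sub_right] at h2
  rw [abs_le] at h1 h2 h3 ⊢
  unfold gap
  constructor <;> linarith [h1.1, h1.2, h2.1, h2.2, h3.1, h3.2]

end SupportFunction

/-! ### Decay of the gap along limit curves -/

section LimitCurve

open MeasureTheory

variable {E : Type*} [NormedAddCommGroup E] [InnerProductSpace ℝ E]

/-- The pair `(a, b)` behaves like two points on a solution of the differential inclusion
`x' ∈ β(F x) - x` that are visited within time `δ`, up to errors of order `δ ^ 2`. That the mean
velocity plus `a` is close to `C` is expressed dually, through all linear functionals `q`. -/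
structure ApproxStep (C : Set E) (F : E → E) (D K δ : ℝ) (a b : E) : Prop where
  norm_le : ‖b - a‖ ≤ D * δ
  le_inner : ∀ q, δ * (minInner C q - inner ℝ q a - ‖q‖ * (D * δ)) ≤ inner ℝ q (b - a)
  inner_le : inner ℝ (F a) (b - a) ≤ δ * (-gap C F a + K * δ)

variable {C : Set E} {F : E → E} {D K : ℝ}

theorem ApproxStep.of_tendsto (hne : C.Nonempty) (hc : IsCompact C) {ι : Type*} {l : Filter ι}
    [l.NeBot] {δ : ι → ℝ} {a b : ι → E} {δ' : ℝ} {a' b' : E}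
    (h : ∀ᶠ i in l, ApproxStep C F D K (δ i) (a i) (b i)) (hδ : Tendsto δ l (𝓝 δ'))
    (ha : Tendsto a l (𝓝 a')) (hb : Tendsto b l (𝓝 b'))
    (hF : Tendsto (fun i => F (a i)) l (𝓝 (F a'))) : ApproxStep C F D K δ' a' b' where
  norm_le := le_of_tendsto_of_tendsto (hb.sub ha).norm (hδ.const_mul D)
    (h.mono fun _ h => h.norm_le)
  le_inner q := by
    have hq : Tendsto (fun _ : ι => q) l (𝓝 q) := tendsto_const_nhds
    exact le_of_tendsto_of_tendsto (hδ.mul (((hq.inner ha).const_sub (minInner C q)).sub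
      ((hδ.const_mul D).const_mul ‖q‖))) (hq.inner (hb.sub ha)) (h.mono fun _ h => h.le_inner q)
  inner_le := by
    have hφ := ((continuous_minInner hne hc).tendsto (F a')).comp hF
    exact le_of_tendsto_of_tendsto (hF.inner (hb.sub ha))
      (hδ.mul (((hF.inner ha).sub hφ).neg.add (hδ.const_mul K))) (h.mono fun _ h => h.inner_le)

/-- The gap function satisfies `(V ∘ y)' ≤ -V ∘ y` wherever the derivatives involved exist.
With `σ = y' + y`, a minimizer of `⟪F y, ·⟫`, the quantity `⟪F (y r), σ⟫ - minInner C (F (y r))` is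
nonnegative in `r` and vanishes at `r = t`, so its derivative at `t` is zero. This expresses the
derivative of the nonsmooth `V ∘ y` through those of `y` and `F ∘ y`, and monotonicity of `F` makes
the term `⟪(F ∘ y)', y'⟫` nonnegative. -/
theorem deriv_gap_le (hmono : ∀ x ∈ C, ∀ z ∈ C, 0 ≤ inner ℝ (F x - F z) (x - z))
    {y : ℝ → E} (hyC : ∀ t, y t ∈ C)
    (hy : ∀ t h, 0 ≤ h → ApproxStep C F D K h (y t) (y (t + h))) {t : ℝ}
    (d1 : DifferentiableAt ℝ y t) (d2 : DifferentiableAt ℝ (fun r => F (y r)) t)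
    (d3 : DifferentiableAt ℝ (fun r => gap C F (y r)) t) :
    deriv (fun r => gap C F (y r)) t ≤ -gap C F (y t) := by
  obtain ⟨v, hv⟩ : ∃ v, HasDerivAt y v t := ⟨_, d1.hasDerivAt⟩
  obtain ⟨w, hw⟩ : ∃ w, HasDerivAt (fun r => F (y r)) w t := ⟨_, d2.hasDerivAt⟩
  have hvs := hv.tendsto_slope_zero_right
  have hws := hw.tendsto_slope_zero_right
  have hid : Tendsto (fun h : ℝ => h) (𝓝[>] 0) (𝓝 0) := nhdsWithin_le_nhds
  have hwv : 0 ≤ inner ℝ w v := by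
    refine ge_of_tendsto (hws.inner hvs) ?_
    filter_upwards [self_mem_nhdsWithin] with h hh
    have hh : (0 : ℝ) < h := hh
    rw [real_inner_smul_left, real_inner_smul_right]
    have := hmono _ (hyC (t + h)) _ (hyC t)
    positivity
  have hlow : ∀ q, minInner C q ≤ inner ℝ q (v + y t) := by
    intro q
    have h1 : Tendsto (fun h : ℝ => minInner C q - inner ℝ q (y t) - ‖q‖ * (D * h)) (𝓝[>] 0)
        (𝓝 (minInner C q - inner ℝ q (y t) - ‖q‖ * (D * 0))) :=
      ((hid.const_mul D).const_mul ‖q‖).const_sub _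
    have h2 := le_of_tendsto_of_tendsto h1 ((tendsto_const_nhds (x := q)).inner hvs) (by
      filter_upwards [self_mem_nhdsWithin] with h hh
      have hh : (0 : ℝ) < h := hh
      rw [real_inner_smul_right, le_inv_mul_iff₀ hh]
      exact (hy t h hh.le).le_inner q)
    rw [inner_add_right]
    linarith
  have hup : inner ℝ (F (y t)) v ≤ -gap C F (y t) := by
    have h1 : Tendsto (fun h : ℝ => -gap C F (y t) + K * h) (𝓝[>] 0)
        (𝓝 (-gap C F (y t) + K * 0)) := (hid.const_mul K).const_add _
    have h2 := le_of_tendsto_of_tendsto ((tendsto_const_nhds (x := F (y t))).inner hvs) h1 (by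
      filter_upwards [self_mem_nhdsWithin] with h hh
      have hh : (0 : ℝ) < h := hh
      rw [real_inner_smul_right, inv_mul_le_iff₀ hh]
      exact (hy t h hh.le).inner_le)
    simpa using h2
  have heq : inner ℝ (F (y t)) (v + y t) = minInner C (F (y t)) := by
    refine le_antisymm ?_ (hlow _)
    rw [inner_add_right]
    unfold gap at hup
    linarith
  have hder := d3.hasDerivAt.sub (hw.inner ℝ (hv.sub_const (v + y t)))
  have hmin : IsLocalMin ((fun r => gap C F (y r)) -
      fun r => inner ℝ (F (y r)) (y r - (v + y t))) t := by
    refine Eventually.of_forall fun r => ?_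
    have := hlow (F (y r))
    simp only [Pi.sub_apply, gap, inner_sub_right]
    linarith
  have h0 := hmin.hasDerivAt_eq_zero hder
  have h1 : y t - (v + y t) = -v := by abel
  rw [h1, inner_neg_right] at h0
  linarith

/-- The inequality `(V ∘ y)' ≤ -V ∘ y` integrated backwards in time. Since `V ≥ 0`, the
composition is antitone, so the integral of `V ∘ y` over `[-T, 0]` is at least `T * V (y 0)`. -/
theorem gap_mul_le (hne : C.Nonempty) (hc : IsCompact C) {L : NNReal} (hF : LipschitzOnWith L F C)
    [FiniteDimensional ℝ E]
    (hmono : ∀ x ∈ C, ∀ z ∈ C, 0 ≤ inner ℝ (F x - F z) (x - z)) (hD : 0 ≤ D)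
    {y : ℝ → E} (hyC : ∀ t, y t ∈ C)
    (hy : ∀ t h, 0 ≤ h → ApproxStep C F D K h (y t) (y (t + h))) {T : ℝ} (hT : 0 ≤ T) :
    gap C F (y 0) * (1 + T) ≤ gap C F (y (-T)) := by
  obtain ⟨R, hR⟩ := hc.isBounded.exists_norm_le
  obtain ⟨B, hB⟩ := (hc.image_of_continuousOn hF.continuousOn).isBounded.exists_norm_le
  replace hB : ∀ z ∈ C, ‖F z‖ ≤ B := fun z hz => hB _ ⟨z, hz, rfl⟩
  have hR0 : 0 ≤ R := (norm_nonneg _).trans (hR _ hne.some_mem)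
  have hB0 : 0 ≤ B := (norm_nonneg _).trans (hB _ hne.some_mem)
  lift R to NNReal using hR0
  lift B to NNReal using hB0
  lift D to NNReal using hD
  have yl : LipschitzWith D y := by
    refine LipschitzWith.of_dist_le_mul fun s t => ?_
    wlog hst : s ≤ t generalizing s t
    · rw [dist_comm, dist_comm s t]
      exact this t s (le_of_not_ge hst)
    have h := (hy s (t - s) (by linarith)).norm_le
    rw [add_sub_cancel] at h
    rw [dist_comm, dist_comm s t, dist_eq_norm, Real.dist_eq, abs_of_nonneg (by linarith)]
    exact h
  have fl : LipschitzWith (L * D) (fun r => F (y r)) := by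
    refine LipschitzWith.of_dist_le_mul fun s t => ?_
    refine (hF.dist_le_mul _ (hyC s) _ (hyC t)).trans ?_
    rw [NNReal.coe_mul, mul_assoc]
    exact mul_le_mul_of_nonneg_left (yl.dist_le_mul s t) L.coe_nonneg
  have gl : LipschitzWith (2 * R * (L * D) + B * D) (fun r => gap C F (y r)) := by
    refine LipschitzWith.of_dist_le_mul fun s t => ?_
    have h1 := abs_gap_sub_le hne hc hR hB (hyC s) (hyC t)
    have h2 := fl.dist_le_mul s t
    have h3 := yl.dist_le_mul s t
    rw [dist_eq_norm] at h2 h3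
    rw [Real.dist_eq (gap C F (y s))]
    have h4 := mul_le_mul_of_nonneg_left h2 (by positivity : (0 : ℝ) ≤ 2 * R)
    have h5 := mul_le_mul_of_nonneg_left h3 B.coe_nonneg
    refine h1.trans ((add_le_add h4 h5).trans_eq ?_)
    push_cast
    ring
  have hgap0 : ∀ t, 0 ≤ gap C F (y t) := fun t => sub_nonneg.2 (minInner_le hc _ (hyC t))
  have hae : ∀ᵐ t, deriv (fun r => gap C F (y r)) t ≤ -gap C F (y t) := by
    filter_upwards [yl.ae_differentiableAt, fl.ae_differentiableAt, gl.ae_differentiableAt]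
      with t d1 d2 d3
    exact deriv_gap_le hmono hyC hy d1 d2 d3
  have hac : ∀ a b, AbsolutelyContinuousOnInterval (fun r => gap C F (y r)) a b := fun a b =>
    (gl.lipschitzOnWith (s := Set.uIcc a b)).absolutelyContinuousOnInterval
  have hanti : ∀ a b, a ≤ b → gap C F (y b) ≤ gap C F (y a) := by
    intro a b hab
    have h1 := (hac a b).integral_deriv_eq_sub
    have h2 : ∫ r in a..b, deriv (fun r => gap C F (y r)) r ≤ 0 :=
      (intervalIntegral.integral_of_le hab).trans_le (integral_nonpos_of_ae
        (ae_restrict_of_ae (hae.mono fun t ht => ht.trans (neg_nonpos.2 (hgap0 t)))))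
    linarith
  have h1 := (hac (-T) 0).integral_deriv_eq_sub
  have h2 : ∫ r in (-T)..0, deriv (fun r => gap C F (y r)) r ≤ ∫ r in (-T)..0, -gap C F (y 0) := by
    refine intervalIntegral.integral_mono_ae_restrict (by linarith)
      (hac (-T) 0).intervalIntegrable_deriv (by simp) ?_
    filter_upwards [ae_restrict_of_ae hae, ae_restrict_mem measurableSet_Icc] with t ht htm
    exact ht.trans (neg_le_neg (hanti t 0 htm.2))
  rw [intervalIntegral.integral_const, smul_eq_mul] at h2
  linarith

end LimitCurve

/-! ### First passage indices -/

section FirstIndex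

/-- The first index at which the sequence `τ` has reached the level `r`. -/
noncomputable def firstIndex (τ : ℕ → ℝ) (r : ℝ) : ℕ := sInf {m | r ≤ τ m}

variable {τ : ℕ → ℝ}

theorem le_firstIndex (hτ : Tendsto τ atTop atTop) (r : ℝ) : r ≤ τ (firstIndex τ r) :=
  Nat.sInf_mem (s := {m | r ≤ τ m}) (hτ.eventually_ge_atTop r).exists

theorem monotone_firstIndex (hτ : Tendsto τ atTop atTop) : Monotone (firstIndex τ) :=
  fun _ _ h => Nat.sInf_le (h.trans (le_firstIndex hτ _))

theorem firstIndex_apply (hmono : StrictMono τ) (hτ : Tendsto τ atTop atTop) (k : ℕ) :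
    firstIndex τ (τ k) = k :=
  le_antisymm (Nat.sInf_le (le_refl (τ k))) (hmono.le_iff_le.1 (le_firstIndex hτ _))

theorem tendsto_firstIndex (hmono : StrictMono τ) (hτ : Tendsto τ atTop atTop) :
    Tendsto (firstIndex τ) atTop atTop :=
  (monotone_firstIndex hτ).tendsto_atTop_atTop fun k => ⟨τ k, (firstIndex_apply hmono hτ k).ge⟩

theorem tendsto_firstIndex_sub (hmono : StrictMono τ) (hτ : Tendsto τ atTop atTop) {γ : ℕ → ℝ}
    (hγ : Tendsto γ atTop (𝓝 0)) (hτγ : ∀ k, τ (k + 1) = τ k + γ (k + 1)) :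
    Tendsto (fun r => τ (firstIndex τ r) - r) atTop (𝓝 0) := by
  refine squeeze_zero' (Eventually.of_forall fun r => sub_nonneg.2 (le_firstIndex hτ r)) ?_
    (hγ.comp (tendsto_firstIndex hmono hτ))
  filter_upwards [(tendsto_firstIndex hmono hτ).eventually_ge_atTop 1] with r hr
  obtain ⟨k, hk⟩ := Nat.exists_eq_add_of_le' hr
  have h : ¬ r ≤ τ k := Nat.notMem_of_lt_sInf (s := {m | r ≤ τ m}) (by
    change k < firstIndex τ r
    omega)
  simp only [Function.comp_apply, hk, hτγ]
  linarith

end FirstIndex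

/-! ### Limit curves of the iteration -/

section Iteration

variable {n : ℕ} {C : Set (EuclideanSpace ℝ (Fin n))}
  {F : EuclideanSpace ℝ (Fin n) → EuclideanSpace ℝ (Fin n)} {γ : ℕ → ℝ}
  {x : ℕ → EuclideanSpace ℝ (Fin n)}

/-- The time elapsed after `k` steps, `γ 1 + ⋯ + γ k`. -/
noncomputable def elapsed (γ : ℕ → ℝ) (k : ℕ) : ℝ := ∑ i ∈ Finset.Icc 1 k, γ i

theorem elapsed_succ (γ : ℕ → ℝ) (k : ℕ) : elapsed γ (k + 1) = elapsed γ k + γ (k + 1) :=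
  Finset.sum_Icc_succ_top (by omega) _

theorem IsStepSize.strictMono_elapsed (hγ : IsStepSize γ) : StrictMono (elapsed γ) :=
  strictMono_nat_of_lt_succ fun k => by
    rw [elapsed_succ]
    linarith [hγ.pos (k + 1) (by omega)]

theorem IsFrankWolfeSeq.mem (hconv : Convex ℝ C) (hγ : IsStepSize γ)
    (hx : IsFrankWolfeSeq C F γ x) (k : ℕ) : x k ∈ C := by
  induction k with
  | zero => exact hx.init
  | succ k ih =>
    obtain ⟨s, hs, h⟩ := hx.step k
    rw [h]
    exact hconv.add_smul_sub_mem ih hs.1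
      ⟨(hγ.pos (k + 1) (by omega)).le, hγ.le_one (k + 1) (by omega)⟩

/-- Over a block of steps of total length `δ` the iterates move by `O(δ)`, hence `F` does so too,
and the oracle points `s j` almost minimize `⟪F (x k), ·⟫` for the initial point `x k`. -/
theorem IsFrankWolfeSeq.exists_approxStep (hc : IsCompact C) (hconv : Convex ℝ C) {L : NNReal}
    (hF : LipschitzOnWith L F C) (hγ : IsStepSize γ) (hx : IsFrankWolfeSeq C F γ x) :
    ∃ D K : ℝ, 0 ≤ D ∧ ∀ k m, k ≤ m →
      ApproxStep C F D K (elapsed γ m - elapsed γ k) (x k) (x m) := by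
  have hne : C.Nonempty := ⟨_, hx.init⟩
  obtain ⟨R, hR⟩ := hc.isBounded.exists_norm_le
  obtain ⟨B, hB⟩ := (hc.image_of_continuousOn hF.continuousOn).isBounded.exists_norm_le
  replace hB : ∀ z ∈ C, ‖F z‖ ≤ B := fun z hz => hB _ ⟨z, hz, rfl⟩
  have hR0 : 0 ≤ R := (norm_nonneg _).trans (hR _ hne.some_mem)
  have hB0 : 0 ≤ B := (norm_nonneg _).trans (hB _ hne.some_mem)
  have hxC := hx.mem hconv hγ
  have hpos : ∀ k, 0 < γ (k + 1) := fun k => hγ.pos _ (by omega)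
  have hτ := hγ.strictMono_elapsed.monotone
  have hnorm : ∀ k m, k ≤ m → ‖x m - x k‖ ≤ 2 * R * (elapsed γ m - elapsed γ k) := by
    intro k m hkm
    induction m, hkm using Nat.le_induction with
    | base => simp
    | succ m hkm ih =>
      obtain ⟨s, hs, h⟩ := hx.step m
      have h1 : ‖s - x m‖ ≤ 2 * R := by
        linarith [norm_sub_le s (x m), hR s hs.1, hR _ (hxC m)]
      have h2 : x (m + 1) - x k = (x m - x k) + γ (m + 1) • (s - x m) := by
        rw [h]
        abel
      have h3 := norm_add_le (x m - x k) (γ (m + 1) • (s - x m))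
      rw [norm_smul, Real.norm_of_nonneg (hpos m).le] at h3
      have h4 := mul_le_mul_of_nonneg_left h1 (hpos m).le
      rw [h2, elapsed_succ]
      linarith
  refine ⟨2 * R, 4 * R ^ 2 * L + 2 * R * B, by positivity, fun k m hkm => ⟨hnorm k m hkm, ?_, ?_⟩⟩
  · intro q
    -- The bound `δ` is decoupled from `m`, so that the error term stays fixed in the induction.
    suffices h : ∀ δ, ∀ m, k ≤ m → elapsed γ m - elapsed γ k ≤ δ →
        (elapsed γ m - elapsed γ k) * (minInner C q - inner ℝ q (x k) - ‖q‖ * (2 * R * δ)) ≤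
          inner ℝ q (x m - x k) from h _ m hkm le_rfl
    intro δ m hkm
    induction m, hkm using Nat.le_induction with
    | base => simp
    | succ m hkm ih =>
      intro hδ
      obtain ⟨s, hs, h⟩ := hx.step m
      have h0 := hτ (Nat.le_succ m)
      have h2 : x (m + 1) - x k = (x m - x k) + γ (m + 1) • (s - x k - (x m - x k)) := by
        rw [h, sub_sub_sub_cancel_right]
        abel
      have h3 : inner ℝ q (x m - x k) ≤ ‖q‖ * (2 * R * δ) :=
        (real_inner_le_norm _ _).trans (mul_le_mul_of_nonneg_left ((hnorm k m hkm).trans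
          (mul_le_mul_of_nonneg_left (by simp only [Nat.succ_eq_add_one] at h0; linarith)
            (by positivity))) (norm_nonneg _))
      have h4 := minInner_le hc q hs.1
      have h5 : minInner C q - inner ℝ q (x k) - ‖q‖ * (2 * R * δ) ≤
          inner ℝ q (s - x k - (x m - x k)) := by
        rw [inner_sub_right q (s - x k), inner_sub_right q s]
        linarith
      have h6 := mul_le_mul_of_nonneg_left h5 (hpos m).le
      have h7 := ih (by simp only [Nat.succ_eq_add_one] at h0; linarith)
      rw [h2, elapsed_succ, inner_add_right, real_inner_smul_right]
      linarith
  · suffices h : ∀ δ, ∀ m, k ≤ m → elapsed γ m - elapsed γ k ≤ δ →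
        inner ℝ (F (x k)) (x m - x k) ≤ (elapsed γ m - elapsed γ k) *
          (-gap C F (x k) + (4 * R ^ 2 * L + 2 * R * B) * δ) from h _ m hkm le_rfl
    intro δ m hkm
    induction m, hkm using Nat.le_induction with
    | base => simp
    | succ m hkm ih =>
      intro hδ
      obtain ⟨s, hs, h⟩ := hx.step m
      have h0 : elapsed γ m ≤ elapsed γ (m + 1) := hτ (Nat.le_succ m)
      have h1 : ‖x m - x k‖ ≤ 2 * R * δ := (hnorm k m hkm).trans
        (mul_le_mul_of_nonneg_left (by linarith) (by positivity))
      have h2 : x (m + 1) - x k = (x m - x k) + γ (m + 1) • (s - x k - (x m - x k)) := by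
        rw [h, sub_sub_sub_cancel_right]
        abel
      have hFd : ‖F (x k) - F (x m)‖ ≤ L * (2 * R * δ) := by
        rw [norm_sub_rev, ← dist_eq_norm]
        refine (hF.dist_le_mul _ (hxC m) _ (hxC k)).trans (mul_le_mul_of_nonneg_left ?_ L.coe_nonneg)
        rwa [dist_eq_norm]
      have h3 : -inner ℝ (F (x k)) (x m - x k) ≤ B * (2 * R * δ) :=
        (neg_le_abs _).trans ((abs_real_inner_le_norm _ _).trans
          (mul_le_mul (hB _ (hxC k)) h1 (norm_nonneg _) hB0))
      obtain ⟨z, hz, hzq⟩ := exists_inner_eq_minInner hne hc (F (x k))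
      have h4 : inner ℝ (F (x k)) s ≤ minInner C (F (x k)) + 2 * R * (L * (2 * R * δ)) := by
        have e1 : inner ℝ (F (x k) - F (x m)) (s - z) ≤ L * (2 * R * δ) * (2 * R) :=
          (real_inner_le_norm _ _).trans (mul_le_mul hFd
            (by linarith [norm_sub_le s z, hR s hs.1, hR z hz]) (norm_nonneg _)
            ((norm_nonneg _).trans hFd))
        rw [inner_sub_left, inner_sub_right, inner_sub_right] at e1
        linarith [hs.2 z hz]
      have h5 : inner ℝ (F (x k)) (s - x k - (x m - x k)) ≤
          -gap C F (x k) + (4 * R ^ 2 * L + 2 * R * B) * δ := by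
        rw [inner_sub_right _ (s - x k), inner_sub_right _ s]
        unfold gap
        linarith
      have h6 := mul_le_mul_of_nonneg_left h5 (hpos m).le
      have h7 := ih (by linarith)
      rw [h2, elapsed_succ, inner_add_right, real_inner_smul_right]
      linarith

/-- The interpolated iterates, shifted in time so that step `k` sits at time `0`, converge pointwise
along an ultrafilter in `k`, because `C` is compact. -/
theorem IsFrankWolfeSeq.exists_limit_curve (hc : IsCompact C) (hconv : Convex ℝ C) {L : NNReal}
    (hF : LipschitzOnWith L F C) (hγ : IsStepSize γ) (hx : IsFrankWolfeSeq C F γ x)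
    {a : EuclideanSpace ℝ (Fin n)} (ha : MapClusterPt a atTop x) :
    ∃ D K : ℝ, 0 ≤ D ∧ ∃ y : ℝ → EuclideanSpace ℝ (Fin n), y 0 = a ∧ (∀ t, y t ∈ C) ∧
      ∀ t h, 0 ≤ h → ApproxStep C F D K h (y t) (y (t + h)) := by
  obtain ⟨U, hU, hUa⟩ := mapClusterPt_iff_ultrafilter.1 ha
  obtain ⟨D, K, hD, hstep⟩ := hx.exists_approxStep hc hconv hF hγ
  have hxC := hx.mem hconv hγ
  have hτ : Tendsto (elapsed γ) atTop atTop := hγ.sum_diverges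
  have hsm := hγ.strictMono_elapsed
  set N : ℝ → ℕ → ℕ := fun t k => firstIndex (elapsed γ) (elapsed γ k + t)
  have hlim : ∀ t, ∃ b ∈ C, Tendsto (fun k => x (N t k)) U (𝓝 b) := fun t =>
    isCompact_iff_ultrafilter_le_nhds'.1 hc (U.map fun k => x (N t k))
      (mem_map.2 (Eventually.of_forall fun k => hxC _))
  choose y hyC hy using hlim
  have hshift : ∀ t, Tendsto (fun k => elapsed γ k + t) U atTop := fun t =>
    (tendsto_atTop_add_const_right _ t hτ).mono_left hU
  have herr : ∀ t, Tendsto (fun k => elapsed γ (N t k) - (elapsed γ k + t)) U (𝓝 0) := fun t =>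
    (tendsto_firstIndex_sub hsm hτ hγ.tendsto_zero (elapsed_succ γ)).comp (hshift t)
  refine ⟨D, K, hD, y, ?_, hyC, fun t h hh => ?_⟩
  · refine tendsto_nhds_unique (hy 0) (hUa.congr fun k => ?_)
    simp only [N, add_zero, firstIndex_apply hsm hτ]
  · refine ApproxStep.of_tendsto ⟨_, hxC 0⟩ hc
      (Eventually.of_forall fun k =>
        hstep (N t k) (N (t + h) k) (monotone_firstIndex hτ (by linarith)))
      ?_ (hy t) (hy (t + h)) ?_
    · have := ((herr (t + h)).sub (herr t)).add_const h
      rw [sub_zero, zero_add] at this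
      refine this.congr fun k => ?_
      ring
    · exact (hF.continuousOn _ (hyC t)).tendsto.comp
        (tendsto_nhdsWithin_iff.2 ⟨hy t, Eventually.of_forall fun k => hxC _⟩)

theorem IsFrankWolfeSeq.mem_SOL_of_mapClusterPt (hc : IsCompact C) (hconv : Convex ℝ C)
    {L : NNReal} (hF : LipschitzOnWith L F C) (hmono : MonotoneOperatorOn C F)
    (hγ : IsStepSize γ) (hx : IsFrankWolfeSeq C F γ x)
    {a : EuclideanSpace ℝ (Fin n)} (ha : MapClusterPt a atTop x) : a ∈ SOL C F := by
  have hne : C.Nonempty := ⟨_, hx.init⟩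
  obtain ⟨D, K, hD, y, rfl, hyC, hy⟩ := hx.exists_limit_curve hc hconv hF hγ ha
  obtain ⟨R, hR⟩ := hc.isBounded.exists_norm_le
  obtain ⟨B, hB⟩ := (hc.image_of_continuousOn hF.continuousOn).isBounded.exists_norm_le
  replace hB : ∀ z ∈ C, ‖F z‖ ≤ B := fun z hz => hB _ ⟨z, hz, rfl⟩
  have hR0 : 0 ≤ R := (norm_nonneg _).trans (hR _ hne.some_mem)
  have hB0 : 0 ≤ B := (norm_nonneg _).trans (hB _ hne.some_mem)
  have hbound : ∀ z ∈ C, gap C F z ≤ 2 * R * B := by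
    intro z hz
    obtain ⟨s, hs, hsz⟩ := exists_inner_eq_minInner hne hc (F z)
    have h1 : ‖z - s‖ ≤ 2 * R := by linarith [norm_sub_le z s, hR z hz, hR s hs]
    have h2 : inner ℝ (F z) (z - s) ≤ B * (2 * R) :=
      (real_inner_le_norm _ _).trans (mul_le_mul (hB z hz) h1 (norm_nonneg _) hB0)
    rw [inner_sub_right, hsz] at h2
    unfold gap
    linarith
  have hgap : gap C F (y 0) ≤ 0 := by
    by_contra! hpos
    have h1 := gap_mul_le hne hc hF hmono hD hyC hy
      (T := 2 * R * B / gap C F (y 0)) (by positivity)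
    rw [mul_add, mul_div_cancel₀ _ hpos.ne'] at h1
    linarith [hbound _ (hyC (-(2 * R * B / gap C F (y 0))))]
  refine ⟨hyC 0, fun z hz => ?_⟩
  have := minInner_le hc (F (y 0)) hz
  unfold gap at hgap
  rw [inner_sub_right]
  linarith

end Iteration

end FWVI

theorem mainTheorem2 {n : ℕ} (C : Set (EuclideanSpace ℝ (Fin n)))
    (hC_nonempty : C.Nonempty) (hC_compact : IsCompact C) (hC_convex : Convex ℝ C)
    (F : EuclideanSpace ℝ (Fin n) → EuclideanSpace ℝ (Fin n))
    (hF_smooth : ContDiffOn ℝ 1 F C) (hF_mono : FWVI.MonotoneOperatorOn C F)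
    (γ : ℕ → ℝ) (hγ : FWVI.IsStepSize γ)
    (x : ℕ → EuclideanSpace ℝ (Fin n)) (hx : FWVI.IsFrankWolfeSeq C F γ x) :
    (∀ a : EuclideanSpace ℝ (Fin n), MapClusterPt a atTop x → a ∈ FWVI.SOL C F) ∧
      (FWVI.SOL C F).Nonempty ∧
      Tendsto (fun k => Metric.infDist (x k) (FWVI.SOL C F)) atTop (𝓝 0) := by
  obtain ⟨L, hL⟩ := hF_smooth.exists_lipschitzOnWith one_ne_zero hC_convex hC_compact
  have hcl : ∀ a, MapClusterPt a atTop x → a ∈ FWVI.SOL C F := fun a ha =>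
    hx.mem_SOL_of_mapClusterPt hC_compact hC_convex hL hF_mono hγ ha
  have hxC := hx.mem hC_convex hγ
  obtain ⟨a, -, ha⟩ := hC_compact.exists_mapClusterPt_of_frequently
    (Eventually.of_forall (f := atTop) hxC).frequently
  refine ⟨hcl, ⟨a, hcl a ha⟩, tendsto_iff_ultrafilter _ _ _ |>.2 fun U hU => ?_⟩
  obtain ⟨b, -, hb⟩ := isCompact_iff_ultrafilter_le_nhds'.1 hC_compact (U.map x)
    (mem_map.2 (Eventually.of_forall hxC))
  have hb : Tendsto x U (𝓝 b) := hb
  have hb' := hcl b (mapClusterPt_iff_ultrafilter.2 ⟨U, hU, hb⟩)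
  have h := ((Metric.continuous_infDist_pt (FWVI.SOL C F)).tendsto b).comp hb
  rwa [Metric.infDist_zero_of_mem hb'] at h
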